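/- Let $n\ge 2$, let $\mathbb{H}^n=\{x\in\mathbb{R}^n : x_1>0\}$ with the metric $g_{\mathbb{H}^n}=x_1^{-2}(dx_1^2+\cdots+dx_n^2)$, and let $\mathbb{H}^n\times_{-1}\mathbb{R}$ be $\mathbb{H}^n\times\mathbb{R}$ with the Lorentzian metric $g_{\mathbb{H}^n}-dt^2$. Put $\rho(x)=-\ln x_1$ (the sign for which $\operatorname{div}(\nabla\rho)=n-1$). Let $\Omega\subseteq\mathbb{H}^n$ be open, connected and non-empty, and let $u\in C^2(\Omega)$. The graph $\Gamma(p)=(p,u(p))$, $p\in\Omega$, is called space-like if its induced metric is positive definite, a translator if its mean curvature vector $\mathbf{H}$ (the trace of the second fundamental form) satisfies $\mathbf{H}=\partial_t^{\perp}$, and foliated by horospheres if through each of its points there passes a horosphere $\{x_1=c\}\times\{t\}$, with $c>0$ and $t\in\mathbb{R}$, that is contained in the graph. Define $$P(x)=-\tfrac14\ln|1-x|+\tfrac12\cdot\tfrac1{1-x}+\tfrac14\ln|1+x|,$$ $$Q(x)=\tfrac{1}{2m-2}\ln|1-x|+\tfrac1{2m+2}\ln|1+x|-\tfrac{m}{m^2-1}\ln|1-mx|,\qquad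 m=n-1>1,$$ which are antiderivatives of $\frac{1}{(1-x^2)(1-x)}$ and $\frac1{(1-x^2)(1-mx)}$, and let $P_2=P|_{(-1,1)}$, $Q_2=Q|_{(-1,1/m)}$, $Q_3=Q|_{(1/m,1)}$, which are bijections onto $\mathbb{R}$. Suppose that $\Gamma$ is a space-like translator. Then $\Gamma$ is foliated by horospheres if and only if there are an open interval $I\subseteq\mathbb{R}$ with $\Omega=\rho^{-1}(I)$ and a $C^2$ function $f:\mathbb{R}\to\mathbb{R}$ such that $u=f\circ\rho$ on $\Omega$ and $f$ is one of the following, where $s_0,f_0\in\mathbb{R}$ are constants: 1. $n>2$ and $f(s)=\frac{s}{n-1}+f_0$; 2. $n=2$ and $f(s)=\int_{s_0}^{s}P_2^{-1}(r-s_0)\,dr+f_0$; 3. $n>2$ and $f(s)=\int_{s_0}^{s}Q_2^{-1}(r-s_0)\,dr+f_0$; 4. $n>2$ and $f(s)=\int_{s_0}^{s}Q_3^{-1}(r-s_0)\,dr+f_0$. Conversely, for each $u$ of this form on $\Omega=\rho^{-1}(I)$, the graph $\Gamma$ is a space-like translator. -/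

import Mathlib

open Set

noncomputable section

namespace HESU

/-! ### Submanifolds of a pseudo-Riemannian metric given in a global chart -/

section PseudoRiemannian

variable {ι κ : Type*} [Fintype ι] [DecidableEq ι] [Fintype κ] [DecidableEq κ]

/-- The partial derivative `∂ᵢ f` at `x`. -/
def pd (i : ι) (f : (ι → ℝ) → ℝ) (x : ι → ℝ) : ℝ :=
  fderiv ℝ f x (Pi.single i 1)

/-- The Christoffel symbol `Γᶜₐᵦ` of the Levi-Civita connection of the metric `g`, at `y`. -/
def christoffel (g : (κ → ℝ) → Matrix κ κ ℝ) (y : κ → ℝ) (c a b : κ) : ℝ :=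
  (1 / 2) * ∑ d, (g y)⁻¹ c d *
    (pd a (fun z => g z b d) y + pd b (fun z => g z a d) y - pd d (fun z => g z a b) y)

/-- The scalar product `g_y(V, W)` of two tangent vectors at `y`. -/
def scal (g : (κ → ℝ) → Matrix κ κ ℝ) (y V W : κ → ℝ) : ℝ :=
  ∑ a, ∑ b, g y a b * V a * W b

/-- The tangent vector `∂ᵢ F` of a map `F` at `x`. -/
def tangentVec (F : (ι → ℝ) → (κ → ℝ)) (x : ι → ℝ) (i : ι) : κ → ℝ :=
  fun c => pd i (fun z => F z c) x

/-- The induced metric `F^* g` at `x`, in coordinates. -/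
def inducedMetric (g : (κ → ℝ) → Matrix κ κ ℝ) (F : (ι → ℝ) → (κ → ℝ)) (x : ι → ℝ) :
    Matrix ι ι ℝ :=
  Matrix.of fun i j => scal g (F x) (tangentVec F x i) (tangentVec F x j)

/-- The normal component `V^⊥` along the immersion `F` of an ambient vector `V` at `F x`
(meaningful where the induced metric is non-degenerate). -/
def normalPart (g : (κ → ℝ) → Matrix κ κ ℝ) (F : (ι → ℝ) → (κ → ℝ)) (x : ι → ℝ)
    (V : κ → ℝ) : κ → ℝ :=
  V - ∑ i, ∑ j,
    ((inducedMetric g F x)⁻¹ i j * scal g (F x) V (tangentVec F x i)) • tangentVec F x j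

/-- The ambient covariant derivative `∇_{∂ᵢ} (∂ⱼ F)` along `F`, at `x`. -/
def covDeriv (g : (κ → ℝ) → Matrix κ κ ℝ) (F : (ι → ℝ) → (κ → ℝ)) (x : ι → ℝ) (i j : ι) :
    κ → ℝ :=
  fun c => pd i (fun z => tangentVec F z j c) x +
    ∑ a, ∑ b, christoffel g (F x) c a b * tangentVec F x i a * tangentVec F x j b

/-- The second fundamental form `II(∂ᵢ, ∂ⱼ)` of `F` at `x`. -/
def secondFundForm (g : (κ → ℝ) → Matrix κ κ ℝ) (F : (ι → ℝ) → (κ → ℝ)) (x : ι → ℝ)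
    (i j : ι) : κ → ℝ :=
  normalPart g F x (covDeriv g F x i j)

/-- The mean curvature vector of `F` at `x`: the trace of the second fundamental form with
respect to the induced metric. -/
def meanCurvatureVector (g : (κ → ℝ) → Matrix κ κ ℝ) (F : (ι → ℝ) → (κ → ℝ)) (x : ι → ℝ) :
    κ → ℝ :=
  ∑ i, ∑ j, (inducedMetric g F x)⁻¹ i j • secondFundForm g F x i j

end PseudoRiemannian

/-! ### Graphs in `ℍⁿ ×₋₁ ℝ`

The half-space coordinates `x₁, …, xₙ` are indexed by `Fin n`, so that `x₁` is `x 0`; the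
coordinates of `ℍⁿ × ℝ` are indexed by `Fin n ⊕ Unit`, the last one being the time `t`. -/

/-- The half-space model of `ℍⁿ`. -/
def halfSpace (n : ℕ) [NeZero n] : Set (Fin n → ℝ) := {x | 0 < x 0}

/-- The Lorentzian metric `x₁⁻² (dx₁² + ⋯ + dxₙ²) - dt²` on `ℍⁿ × ℝ`. -/
def metric (n : ℕ) [NeZero n] (y : Fin n ⊕ Unit → ℝ) :
    Matrix (Fin n ⊕ Unit) (Fin n ⊕ Unit) ℝ :=
  Matrix.diagonal (Sum.elim (fun _ => 1 / (y (Sum.inl 0)) ^ 2) (fun _ => -1))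

/-- The coordinate field `∂ₜ`. -/
def timeField (n : ℕ) : Fin n ⊕ Unit → ℝ := Pi.single (Sum.inr ()) 1

/-- The graph map `p ↦ (p, u p)`. -/
def graphMap {n : ℕ} (u : (Fin n → ℝ) → ℝ) (x : Fin n → ℝ) : Fin n ⊕ Unit → ℝ :=
  Sum.elim x (fun _ => u x)

/-- The graph of `u` over `Ω` is space-like: the induced metric is positive definite. -/
def IsSpacelike {n : ℕ} [NeZero n] (Ω : Set (Fin n → ℝ)) (u : (Fin n → ℝ) → ℝ) : Prop :=
  ∀ x ∈ Ω, (inducedMetric (metric n) (graphMap u) x).PosDef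

/-- The graph of `u` over `Ω` is a translator: `H = ∂ₜ^⊥`. -/
def IsTranslator {n : ℕ} [NeZero n] (Ω : Set (Fin n → ℝ)) (u : (Fin n → ℝ) → ℝ) : Prop :=
  ∀ x ∈ Ω, meanCurvatureVector (metric n) (graphMap u) x =
    normalPart (metric n) (graphMap u) x (timeField n)

/-! ### Horospheres -/

/-- The horosphere `{x₁ = c}` (for `c > 0`). -/
def horosphere (n : ℕ) [NeZero n] (c : ℝ) : Set (Fin n → ℝ) := {x | x 0 = c}

/-- The graph of `u` over `Ω` is foliated by horospheres: through each of its points there is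
a horosphere `{x₁ = c} × {t}` that is contained in the graph. -/
def FoliatedByHorospheres {n : ℕ} [NeZero n] (Ω : Set (Fin n → ℝ)) (u : (Fin n → ℝ) → ℝ) :
    Prop :=
  ∀ z ∈ Ω.graphOn u, ∃ c > 0, ∃ t : ℝ,
    z ∈ horosphere n c ×ˢ {t} ∧ horosphere n c ×ˢ {t} ⊆ Ω.graphOn u

/-- The function `ρ = - ln x₁`, whose level sets are the horospheres `{x₁ = c}`, with the sign
for which `div (∇ρ) = n - 1`. -/
def rho {n : ℕ} [NeZero n] (x : Fin n → ℝ) : ℝ := -Real.log (x 0)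

/-! ### The profiles -/

/-- An antiderivative of `1 / ((1 - x²) (1 - x))`. -/
def P (x : ℝ) : ℝ :=
  -(1 / 4) * Real.log |1 - x| + 1 / 2 * (1 / (1 - x)) + 1 / 4 * Real.log |1 + x|

/-- An antiderivative of `1 / ((1 - x²) (1 - m x))`, for `m > 1`. -/
def Q (m x : ℝ) : ℝ :=
  1 / (2 * m - 2) * Real.log |1 - x| + 1 / (2 * m + 2) * Real.log |1 + x| -
    m / (m ^ 2 - 1) * Real.log |1 - m * x|

/-- `w : ℝ → J` is the two-sided inverse of the restriction `h|_J : J → ℝ`. -/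
def IsInverseOn (h : ℝ → ℝ) (J : Set ℝ) (w : ℝ → ℝ) : Prop :=
  MapsTo w univ J ∧ InvOn w h J univ

/-- `f(s) = ∫_{s₀}^s (h|_J)⁻¹(r - s₀) dr + f₀` for some constants `s₀`, `f₀`, where
`h|_J : J → ℝ` is bijective. -/
def IsPrimitiveOfInverse (h : ℝ → ℝ) (J : Set ℝ) (f : ℝ → ℝ) : Prop :=
  ∃ w : ℝ → ℝ, IsInverseOn h J w ∧
    ∃ s₀ f₀ : ℝ, ∀ s, f s = (∫ r in s₀..s, w (r - s₀)) + f₀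

/-- The list of profile functions. -/
def IsProfile (n : ℕ) (f : ℝ → ℝ) : Prop :=
  (2 < n ∧ ∃ f₀ : ℝ, ∀ s, f s = s / ((n : ℝ) - 1) + f₀) ∨
  (n = 2 ∧ IsPrimitiveOfInverse P (Ioo (-1) 1) f) ∨
  (2 < n ∧ IsPrimitiveOfInverse (Q ((n : ℝ) - 1)) (Ioo (-1) (1 / ((n : ℝ) - 1))) f) ∨
  (2 < n ∧ IsPrimitiveOfInverse (Q ((n : ℝ) - 1)) (Ioo (1 / ((n : ℝ) - 1)) 1) f)

/-- `u : Ω → ℝ` is the function `f ∘ ρ : ρ⁻¹(I) → ℝ` for an open interval `I` and a `C²`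
function `f` of the list (the members of the list are defined on the whole line). -/
def HasListedProfile {n : ℕ} [NeZero n] (Ω : Set (Fin n → ℝ)) (u : (Fin n → ℝ) → ℝ) : Prop :=
  ∃ I : Set ℝ, IsOpen I ∧ I.OrdConnected ∧ Ω = {x ∈ halfSpace n | rho x ∈ I} ∧
    ∃ f : ℝ → ℝ, ContDiff ℝ 2 f ∧ IsProfile n f ∧ ∀ x ∈ Ω, u x = f (rho x)

end HESU

end

/-!
Since `∂ₜ` is parallel, the ambient second derivatives of the graph map of `u` are
`∇ᵢ∂ⱼΓ = (tangential) + Hess u(∂ᵢ, ∂ⱼ) ∂ₜ`, with the hyperbolic Hessian. Hence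
`H = (tr_G Hess u) ∂ₜ^⊥`, where `G` is the induced metric, and as `∂ₜ` is never tangent to a graph,
the translators are the solutions of `tr_G Hess u = 1`. For `u = f ∘ ρ` the graph is space-like iff
`|f'| < 1`, and the equation becomes `f'' = (1 - f'²) (1 - (n - 1) f')`, autonomous and of first
order in `w = f'`.

In `(-1, 1)` the right-hand side vanishes only at `w = 1 / (n - 1)`, and only if `n > 2`. By
uniqueness a solution that takes this value is constant, and any other one stays on one side of it,
where it is inverted by an antiderivative of the reciprocal of the right-hand side: `P` or `Q`.
A horosphere is a fibre of `ρ`, so the graphs foliated by horospheres are those of the functions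
`f ∘ ρ`.
-/

namespace HESU

open Filter Topology

section PartialDerivatives

variable {ι : Type*} [DecidableEq ι]

theorem pd_comp_apply [Finite ι] {φ : ℝ → ℝ} {φ' : ℝ} {x : ι → ℝ} {k : ι}
    (hφ : HasDerivAt φ φ' (x k)) (i : ι) :
    pd i (fun z => φ (z k)) x = if i = k then φ' else 0 := by
  have := Fintype.ofFinite ι
  have h : HasFDerivAt (fun z : ι → ℝ => φ (z k))
      (φ' • ContinuousLinearMap.proj (R := ℝ) (φ := fun _ : ι => ℝ) k) x :=
    hφ.comp_hasFDerivAt x (hasFDerivAt_apply k x)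
  simp [pd, h.fderiv, Pi.single_apply, eq_comm]

theorem pd_apply [Finite ι] (i k : ι) (x : ι → ℝ) :
    pd i (fun z => z k) x = if i = k then 1 else 0 :=
  pd_comp_apply (hasDerivAt_id _) i

theorem pd_const (i : ι) (a : ℝ) (x : ι → ℝ) : pd i (fun _ => a) x = 0 := by
  simp [pd]

theorem pd_congr {u v : (ι → ℝ) → ℝ} {x : ι → ℝ} (h : u =ᶠ[𝓝 x] v) (i : ι) :
    pd i u x = pd i v x := by
  rw [pd, pd, h.fderiv_eq]

end PartialDerivatives

section PseudoRiemannian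

variable {ι κ : Type*} [Fintype ι] [DecidableEq ι] [Fintype κ]
  {g : (κ → ℝ) → Matrix κ κ ℝ} {F : (ι → ℝ) → (κ → ℝ)} {x : ι → ℝ}

theorem christoffel_of_inv_eq_diagonal [DecidableEq κ] {y d : κ → ℝ}
    (hd : (g y)⁻¹ = Matrix.diagonal d) (c a b : κ) :
    christoffel g y c a b = 1 / 2 * (d c *
      (pd a (fun z => g z b c) y + pd b (fun z => g z a c) y - pd c (fun z => g z a b) y)) := by
  simp [christoffel, hd, Matrix.diagonal_apply]

theorem normalPart_tangentVec (hG : IsUnit (inducedMetric g F x).det) (k : ι) :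
    normalPart g F x (tangentVec F x k) = 0 := by
  have coeff (j : ι) : ∑ i, (inducedMetric g F x)⁻¹ i j *
      scal g (F x) (tangentVec F x k) (tangentVec F x i) = (1 : Matrix ι ι ℝ) k j := by
    rw [← Matrix.mul_nonsing_inv _ hG, Matrix.mul_apply]
    exact Finset.sum_congr rfl fun i _ => mul_comm _ _
  rw [normalPart, Finset.sum_comm]
  simp [← Finset.sum_smul, coeff, Matrix.one_apply]

theorem scal_eq_toBilin' [DecidableEq κ] (y V W : κ → ℝ) :
    scal g y V W = Matrix.toBilin' (g y) V W := by
  simp only [scal, Matrix.toBilin'_apply]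
  exact Finset.sum_congr rfl fun a _ => Finset.sum_congr rfl fun b _ => by ring

/-- The normal projection `V ↦ V^⊥` along the immersion `F`, as a linear map. -/
noncomputable def normalProjection [DecidableEq κ] (g : (κ → ℝ) → Matrix κ κ ℝ)
    (F : (ι → ℝ) → (κ → ℝ)) (x : ι → ℝ) : (κ → ℝ) →ₗ[ℝ] (κ → ℝ) :=
  LinearMap.id - ∑ i, ∑ j, (inducedMetric g F x)⁻¹ i j •
    ((Matrix.toBilin' (g (F x))).flip (tangentVec F x i)).smulRight (tangentVec F x j)

theorem normalProjection_apply [DecidableEq κ] (V : κ → ℝ) :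
    normalProjection g F x V = normalPart g F x V := by
  simp [normalProjection, normalPart, scal_eq_toBilin', LinearMap.sum_apply, mul_smul]

theorem normalPart_sum_smul_tangentVec_add (hG : IsUnit (inducedMetric g F x).det)
    (c : ι → ℝ) (b : ℝ) (V : κ → ℝ) :
    normalPart g F x (∑ k, c k • tangentVec F x k + b • V) = b • normalPart g F x V := by
  classical
  rw [← normalProjection_apply, map_add, map_sum]
  simp only [map_smul, normalProjection_apply, normalPart_tangentVec hG, smul_zero,
    Finset.sum_const_zero, zero_add]

end PseudoRiemannian

/-! ### The translator equation of a graph -/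

section GraphGeometry

variable {n : ℕ}

theorem tangentVec_graphMap (u : (Fin n → ℝ) → ℝ) (x : Fin n → ℝ) (i : Fin n) :
    tangentVec (graphMap u) x i = Sum.elim (Pi.single i 1) (fun _ => pd i u x) := by
  ext (k | _)
  · simp [tangentVec, graphMap, pd_apply, Pi.single_apply, eq_comm]
  · simp [tangentVec, graphMap]

variable [NeZero n]

theorem scal_metric (y V W : Fin n ⊕ Unit → ℝ) :
    scal (metric n) y V W =
      (∑ k, V (Sum.inl k) * W (Sum.inl k)) / y (Sum.inl 0) ^ 2 -
        V (Sum.inr ()) * W (Sum.inr ()) := by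
  simp [scal_eq_toBilin', Matrix.toBilin'_apply, metric, Matrix.diagonal_apply,
    Fintype.sum_sum_type, Finset.sum_mul, sub_eq_add_neg, mul_right_comm, div_eq_mul_inv]

theorem inv_metric {y : Fin n ⊕ Unit → ℝ} (hy : y (Sum.inl 0) ≠ 0) :
    (metric n y)⁻¹ =
      Matrix.diagonal (Sum.elim (fun _ => y (Sum.inl 0) ^ 2) (fun _ => -1)) := by
  refine Matrix.inv_eq_left_inv ?_
  rw [metric, Matrix.diagonal_mul_diagonal, Matrix.diagonal_eq_one]
  ext (k | k) <;> simp [hy]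

theorem pd_metric {y : Fin n ⊕ Unit → ℝ} (hy : y (Sum.inl 0) ≠ 0) (a b d : Fin n ⊕ Unit) :
    pd a (fun z => metric n z b d) y =
      if a = Sum.inl 0 ∧ b = d ∧ b ≠ Sum.inr () then -2 / y (Sum.inl 0) ^ 3 else 0 := by
  have inv_sq : HasDerivAt (fun t : ℝ => (t ^ 2)⁻¹) (-2 / y (Sum.inl 0) ^ 3)
      (y (Sum.inl 0)) := by
    refine ((hasDerivAt_pow 2 (y (Sum.inl 0))).fun_inv (pow_ne_zero 2 hy)).congr_deriv ?_
    push_cast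
    field_simp
  rcases eq_or_ne b d with rfl | hbd
  · rcases b with k | k
    · simp [metric, pd_comp_apply (φ := fun t => (t ^ 2)⁻¹) inv_sq]
    · simp [metric, pd_const]
  · simp [metric, hbd, pd_const]

theorem christoffel_metric_inl {y : Fin n ⊕ Unit → ℝ} (hy : y (Sum.inl 0) ≠ 0)
    (k i j : Fin n) :
    christoffel (metric n) y (Sum.inl k) (Sum.inl i) (Sum.inl j) =
      -(1 / y (Sum.inl 0)) * ((if i = 0 ∧ j = k then 1 else 0) +
        (if j = 0 ∧ i = k then 1 else 0) - (if k = 0 ∧ i = j then 1 else 0)) := by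
  simp only [christoffel_of_inv_eq_diagonal (inv_metric hy), pd_metric hy, Sum.elim_inl,
    Sum.inl.injEq, ne_eq, reduceCtorEq, not_false_eq_true, and_true,
    ← mul_boole _ (-2 / y (Sum.inl 0) ^ 3)]
  field_simp
  ring

theorem christoffel_metric_inr_left {y : Fin n ⊕ Unit → ℝ} (hy : y (Sum.inl 0) ≠ 0)
    (a b : Fin n ⊕ Unit) : christoffel (metric n) y (Sum.inr ()) a b = 0 := by
  rw [christoffel_of_inv_eq_diagonal (inv_metric hy)]
  rcases a with a | a <;> rcases b with b | b <;> simp [pd_metric hy]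

theorem christoffel_metric_inr_middle {y : Fin n ⊕ Unit → ℝ} (hy : y (Sum.inl 0) ≠ 0)
    (c b : Fin n ⊕ Unit) : christoffel (metric n) y c (Sum.inr ()) b = 0 := by
  rw [christoffel_of_inv_eq_diagonal (inv_metric hy)]
  rcases c with c | c <;> rcases b with b | b <;> simp [pd_metric hy]

theorem christoffel_metric_inr_right {y : Fin n ⊕ Unit → ℝ} (hy : y (Sum.inl 0) ≠ 0)
    (c a : Fin n ⊕ Unit) : christoffel (metric n) y c a (Sum.inr ()) = 0 := by
  rw [christoffel_of_inv_eq_diagonal (inv_metric hy)]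
  rcases c with c | c <;> rcases a with a | a <;> simp [pd_metric hy]

/-- The Hessian `∂ᵢ∂ⱼu - Γᵏᵢⱼ ∂ₖu` of `u` for the hyperbolic metric, whose Christoffel symbols
are the spatial ones of the product metric. -/
noncomputable def hyperbolicHessian (u : (Fin n → ℝ) → ℝ) (x : Fin n → ℝ) (i j : Fin n) : ℝ :=
  pd i (pd j u) x -
    ∑ k, christoffel (metric n) (graphMap u x) (Sum.inl k) (Sum.inl i) (Sum.inl j) * pd k u x

variable {u : (Fin n → ℝ) → ℝ} {x : Fin n → ℝ}

theorem hyperbolicHessian_eq (hx : x 0 ≠ 0) (i j : Fin n) :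
    hyperbolicHessian u x i j = pd i (pd j u) x + 1 / x 0 *
      ((if i = 0 then pd j u x else 0) + (if j = 0 then pd i u x else 0) -
        (if i = j then pd 0 u x else 0)) := by
  have hy : graphMap u x (Sum.inl 0) ≠ 0 := hx
  simp only [hyperbolicHessian, christoffel_metric_inl hy, mul_assoc, ← Finset.mul_sum, sub_mul,
    add_mul, ite_mul, one_mul, zero_mul, Finset.sum_sub_distrib, Finset.sum_add_distrib]
  have sum_ite (p : Prop) [Decidable p] (a : Fin n) :
      (∑ k, if p then if a = k then pd k u x else 0 else 0) = if p then pd a u x else 0 := by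
    split_ifs <;> simp
  simp [graphMap, ite_and, sum_ite]

theorem covDeriv_graphMap (hx : x 0 ≠ 0) (i j : Fin n) :
    covDeriv (metric n) (graphMap u) x i j =
      ∑ k, christoffel (metric n) (graphMap u x) (Sum.inl k) (Sum.inl i) (Sum.inl j) •
        tangentVec (graphMap u) x k + hyperbolicHessian u x i j • timeField n := by
  have hy : graphMap u x (Sum.inl 0) ≠ 0 := hx
  ext (k | k)
  · simp [covDeriv, tangentVec_graphMap, christoffel_metric_inr_middle hy,
      christoffel_metric_inr_right hy, pd_const, timeField, Pi.single_apply]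
  · simp [covDeriv, tangentVec_graphMap, christoffel_metric_inr_left hy, timeField,
      hyperbolicHessian]

theorem meanCurvatureVector_graphMap (hx : x 0 ≠ 0)
    (hG : IsUnit (inducedMetric (metric n) (graphMap u) x).det) :
    meanCurvatureVector (metric n) (graphMap u) x =
      (∑ i, ∑ j, (inducedMetric (metric n) (graphMap u) x)⁻¹ i j * hyperbolicHessian u x i j) •
        normalPart (metric n) (graphMap u) x (timeField n) := by
  simp only [meanCurvatureVector, secondFundForm, covDeriv_graphMap hx,
    normalPart_sum_smul_tangentVec_add hG, smul_smul, Finset.sum_smul]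

theorem normalPart_timeField_ne_zero :
    normalPart (metric n) (graphMap u) x (timeField n) ≠ 0 := by
  obtain ⟨c, hc⟩ : ∃ c : Fin n → ℝ, normalPart (metric n) (graphMap u) x (timeField n) =
      timeField n - ∑ j, c j • tangentVec (graphMap u) x j :=
    ⟨_, by rw [normalPart, Finset.sum_comm]; simp only [← Finset.sum_smul]; rfl⟩
  intro h
  rw [hc] at h
  have coeff_eq_zero (k : Fin n) : c k = 0 := by
    simpa [timeField, tangentVec_graphMap, Pi.single_apply] using congrFun h (Sum.inl k)
  simpa [timeField, coeff_eq_zero] using congrFun h (Sum.inr ())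

theorem meanCurvatureVector_eq_normalPart_timeField_iff (hx : x 0 ≠ 0)
    (hG : IsUnit (inducedMetric (metric n) (graphMap u) x).det) :
    meanCurvatureVector (metric n) (graphMap u) x =
        normalPart (metric n) (graphMap u) x (timeField n) ↔
      ∑ i, ∑ j, (inducedMetric (metric n) (graphMap u) x)⁻¹ i j * hyperbolicHessian u x i j =
        1 := by
  rw [meanCurvatureVector_graphMap hx hG]
  simpa using (smul_left_injective ℝ normalPart_timeField_ne_zero).eq_iff (b := (1 : ℝ))

end GraphGeometry

/-! ### Functions of the form `f ∘ ρ` -/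

section RadialFunctions

variable {n : ℕ} [NeZero n] {u : (Fin n → ℝ) → ℝ} {x : Fin n → ℝ} {p q : ℝ}

/-- The profile equation is `w' = profileField (n - 1) w`. -/
noncomputable def profileField (m x : ℝ) : ℝ := (1 - x ^ 2) * (1 - m * x)

theorem inducedMetric_graphMap (u : (Fin n → ℝ) → ℝ) (x : Fin n → ℝ) :
    inducedMetric (metric n) (graphMap u) x =
      Matrix.of fun i j => (if i = j then 1 / x 0 ^ 2 else 0) - pd i u x * pd j u x := by
  ext i j
  simp [inducedMetric, scal_metric, tangentVec_graphMap, graphMap, Pi.single_apply, ite_div,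
    eq_comm]

/-- The partial derivatives at `x`, as far as the translator equation needs them, of a function
`f ∘ ρ` with `f' (ρ x) = p` and `f'' (ρ x) = q`. -/
structure HasRadialJet (u : (Fin n → ℝ) → ℝ) (x : Fin n → ℝ) (p q : ℝ) : Prop where
  pd_eq (i : Fin n) : pd i u x = if i = 0 then -p / x 0 else 0
  pd_pd_eq (i : Fin n) : pd i (pd i u) x = if i = 0 then (q + p) / x 0 ^ 2 else 0

namespace HasRadialJet

theorem inducedMetric_eq (h : HasRadialJet u x p q) :
    inducedMetric (metric n) (graphMap u) x =
      Matrix.diagonal fun i => (if i = 0 then 1 - p ^ 2 else 1) / x 0 ^ 2 := by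
  rw [inducedMetric_graphMap]
  ext i j
  simp only [Matrix.of_apply, h.pd_eq, Matrix.diagonal_apply]
  split_ifs <;> simp_all
  ring

theorem posDef_iff (h : HasRadialJet u x p q) (hx : 0 < x 0) :
    (inducedMetric (metric n) (graphMap u) x).PosDef ↔ p ∈ Ioo (-1) 1 := by
  have hx2 : 0 < x 0 ^ 2 := by positivity
  rw [h.inducedMetric_eq, Matrix.posDef_diagonal_iff, mem_Ioo, ← abs_lt,
    ← sq_lt_one_iff_abs_lt_one]
  simp only [div_pos_iff_of_pos_right hx2]
  refine ⟨fun H => by simpa using H 0, fun H i => ?_⟩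
  split_ifs <;> linarith

theorem inducedMetric_inv (h : HasRadialJet u x p q) (hx : x 0 ≠ 0) (hp : 1 - p ^ 2 ≠ 0) :
    (inducedMetric (metric n) (graphMap u) x)⁻¹ =
      Matrix.diagonal fun i => x 0 ^ 2 / (if i = 0 then 1 - p ^ 2 else 1) := by
  refine Matrix.inv_eq_left_inv ?_
  rw [h.inducedMetric_eq, Matrix.diagonal_mul_diagonal, Matrix.diagonal_eq_one]
  ext i
  dsimp only [Pi.one_apply]
  split_ifs <;> field_simp

theorem hyperbolicHessian_self (h : HasRadialJet u x p q) (hx : x 0 ≠ 0) (i : Fin n) :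
    hyperbolicHessian u x i i = (if i = 0 then q else p) / x 0 ^ 2 := by
  simp only [hyperbolicHessian_eq hx, h.pd_pd_eq, h.pd_eq, if_true]
  split_ifs <;> field_simp <;> ring

theorem trace_hyperbolicHessian (h : HasRadialJet u x p q) (hx : x 0 ≠ 0)
    (hp : 1 - p ^ 2 ≠ 0) :
    ∑ i, ∑ j, (inducedMetric (metric n) (graphMap u) x)⁻¹ i j * hyperbolicHessian u x i j =
      q / (1 - p ^ 2) + ((n : ℝ) - 1) * p := by
  have term (i : Fin n) : x 0 ^ 2 / (if i = 0 then 1 - p ^ 2 else 1) *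
      hyperbolicHessian u x i i = (if i = 0 then q / (1 - p ^ 2) - p else 0) + p := by
    rw [h.hyperbolicHessian_self hx]
    split_ifs <;> field_simp <;> ring
  simp only [h.inducedMetric_inv hx hp, Matrix.diagonal_apply, ite_mul, zero_mul,
    Finset.sum_ite_eq, Finset.mem_univ, if_true, term, Finset.sum_add_distrib,
    Finset.sum_ite_eq', Finset.sum_const, Finset.card_univ, Fintype.card_fin, nsmul_eq_mul]
  ring

theorem meanCurvatureVector_eq_iff (h : HasRadialJet u x p q) (hx : 0 < x 0)
    (hp : p ∈ Ioo (-1) 1) :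
    meanCurvatureVector (metric n) (graphMap u) x =
        normalPart (metric n) (graphMap u) x (timeField n) ↔
      q = profileField ((n : ℝ) - 1) p := by
  have hp' : 1 - p ^ 2 ≠ 0 := by nlinarith [hp.1, hp.2]
  rw [meanCurvatureVector_eq_normalPart_timeField_iff hx.ne'
    ((h.posDef_iff hx).2 hp).det_pos.ne'.isUnit, h.trace_hyperbolicHessian hx.ne' hp',
    profileField, ← eq_sub_iff_add_eq, div_eq_iff hp', mul_comm]

end HasRadialJet

theorem pd_comp_rho {f : ℝ → ℝ} (hx : x 0 ≠ 0) (hf : HasDerivAt f p (rho x)) (i : Fin n) :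
    pd i (fun z => f (rho z)) x = if i = 0 then -p / x 0 else 0 := by
  rw [show -p / x 0 = p * -(x 0)⁻¹ by ring]
  exact pd_comp_apply (hf.comp (x 0) (Real.hasDerivAt_log hx).neg) i

theorem continuousAt_rho (hx : x 0 ≠ 0) : ContinuousAt (rho (n := n)) x :=
  ((continuousAt_apply 0 x).log hx).neg

theorem exp_rho (hx : 0 < x 0) : Real.exp (rho x) = (x 0)⁻¹ := by
  rw [rho, Real.exp_neg, Real.exp_log hx]

theorem hasRadialJet_of_eventuallyEq {f w : ℝ → ℝ} (hx : 0 < x 0)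
    (hu : u =ᶠ[𝓝 x] fun z => f (rho z)) (hf : ∀ᶠ s in 𝓝 (rho x), HasDerivAt f (w s) s)
    (hw : HasDerivAt w q (rho x)) : HasRadialJet u x (w (rho x)) q where
  pd_eq i := by rw [pd_congr hu, pd_comp_rho hx.ne' hf.self_of_nhds]
  pd_pd_eq i := by
    have pd_u : pd i u =ᶠ[𝓝 x] fun z => if i = 0 then -(w (rho z) * Real.exp (rho z)) else 0 := by
      filter_upwards [hu.eventually_nhds, (continuousAt_rho hx.ne').eventually hf,
        (continuousAt_apply 0 x).eventually (eventually_gt_nhds hx)] with z hz hfz hz0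
      rw [pd_congr hz, pd_comp_rho hz0.ne' hfz, exp_rho hz0, neg_div, div_eq_mul_inv]
    rw [pd_congr pd_u]
    rcases eq_or_ne i 0 with rfl | hi
    · have slope : HasDerivAt (fun s => -(w s * Real.exp s))
          (-(q * Real.exp (rho x) + w (rho x) * Real.exp (rho x))) (rho x) :=
        (hw.mul (Real.hasDerivAt_exp _)).neg
      simp only [if_true, pd_comp_rho hx.ne' slope, exp_rho hx]
      field_simp
    · simp only [hi, if_false, pd_const]

end RadialFunctions

/-! ### Autonomous scalar equations -/

section AutonomousEquation

variable {v h f w W : ℝ → ℝ} {J I : Set ℝ}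

/-- On `I` the function `f` has derivative `w`, and `w` is a `J`-valued solution of the autonomous
equation `w' = v w`; thus `f` solves `f'' = v f'`. -/
structure IsSolutionOn (v : ℝ → ℝ) (J I : Set ℝ) (f w : ℝ → ℝ) : Prop where
  hasDerivAt (s : ℝ) (hs : s ∈ I) : HasDerivAt f (w s) s
  hasDerivAt_slope (s : ℝ) (hs : s ∈ I) : HasDerivAt w (v (w s)) s
  mapsTo : MapsTo w I J

namespace IsSolutionOn

theorem mono {J' I' : Set ℝ} (H : IsSolutionOn v J I f w) (hJ : J ⊆ J') (hI : I' ⊆ I) :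
    IsSolutionOn v J' I' f w where
  hasDerivAt s hs := H.hasDerivAt s (hI hs)
  hasDerivAt_slope s hs := H.hasDerivAt_slope s (hI hs)
  mapsTo := H.mapsTo.mono hI hJ

theorem continuousOn_slope (H : IsSolutionOn v J I f w) : ContinuousOn w I := fun s hs =>
  (H.hasDerivAt_slope s hs).continuousAt.continuousWithinAt

theorem contDiff (H : IsSolutionOn v J univ f w) (hv : Continuous v) : ContDiff ℝ 2 f := by
  have deriv_f : deriv f = w := funext fun s => (H.hasDerivAt s (mem_univ s)).deriv
  have deriv_w : deriv w = v ∘ w := funext fun s => (H.hasDerivAt_slope s (mem_univ s)).deriv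
  have hw : ContDiff ℝ 1 w := by
    rw [contDiff_one_iff_deriv, deriv_w]
    exact ⟨fun s => (H.hasDerivAt_slope s (mem_univ s)).differentiableAt,
      hv.comp (continuousOn_univ.1 H.continuousOn_slope)⟩
  rw [show (2 : WithTop ℕ∞) = 1 + 1 by norm_num, contDiff_succ_iff_deriv, deriv_f]
  exact ⟨fun s => (H.hasDerivAt s (mem_univ s)).differentiableAt, by simp, hw⟩

end IsSolutionOn

theorem eqOn_of_hasDerivAt_of_locallyLipschitz {E : Type*} [NormedAddCommGroup E]
    [NormedSpace ℝ E] {v : E → E} {w₁ w₂ : ℝ → E} {s₀ : ℝ} (hv : LocallyLipschitz v)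
    (hIo : IsOpen I) (hI : IsPreconnected I) (h₁ : ∀ s ∈ I, HasDerivAt w₁ (v (w₁ s)) s)
    (h₂ : ∀ s ∈ I, HasDerivAt w₂ (v (w₂ s)) s) (hs₀ : s₀ ∈ I) (heq : w₁ s₀ = w₂ s₀) :
    EqOn w₁ w₂ I := by
  have unique_near : ∀ s ∈ I, w₁ s = w₂ s → w₁ =ᶠ[𝓝 s] w₂ := fun s hs hws => by
    obtain ⟨K, t, ht, hK⟩ := hv (w₁ s)
    refine ODE_solution_unique_of_eventually (v := fun _ => v) (s := fun _ => t)
      (Eventually.of_forall fun _ => hK) ?_ ?_ hws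
    · filter_upwards [hIo.mem_nhds hs, (h₁ s hs).continuousAt.eventually ht] with r hr hrt
      exact ⟨h₁ r hr, hrt⟩
    · filter_upwards [hIo.mem_nhds hs, (h₂ s hs).continuousAt.eventually (hws ▸ ht)] with r hr hrt
      exact ⟨h₂ r hr, hrt⟩
  have subset : I ⊆ {s | w₁ =ᶠ[𝓝 s] w₂} := by
    refine hI.subset_of_closure_inter_subset isOpen_setOfPred_eventually_nhds
      ⟨s₀, hs₀, unique_near s₀ hs₀ heq⟩ fun s hs => unique_near s hs.2 ?_
    exact tendsto_nhds_unique_of_frequently_eq (h₁ s hs.2).continuousAt (h₂ s hs.2).continuousAt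
      ((mem_closure_iff_frequently.1 hs.1).mono fun _ hr => hr.self_of_nhds)
  exact fun s hs => (subset hs).self_of_nhds

theorem IsSolutionOn.eqOn_or_mapsTo_or_mapsTo {a b c : ℝ}
    (H : IsSolutionOn v (Ioo a b) I f w) (hv : LocallyLipschitz v) (hc : v c = 0)
    (hIo : IsOpen I) (hI : IsPreconnected I) :
    EqOn w (fun _ => c) I ∨ MapsTo w I (Ioo a c) ∨ MapsTo w I (Ioo c b) := by
  by_cases hex : ∃ s ∈ I, w s = c
  · obtain ⟨s₀, hs₀, heq⟩ := hex
    exact .inl <| eqOn_of_hasDerivAt_of_locallyLipschitz hv hIo hI H.hasDerivAt_slope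
      (fun s _ => by simpa only [hc] using hasDerivAt_const s c) hs₀ heq
  push Not at hex
  right
  have cover : w '' I ⊆ Iio c ∪ Ioi c := by
    rintro _ ⟨s, hs, rfl⟩
    exact (hex s hs).lt_or_gt
  refine ((hI.image w H.continuousOn_slope).subset_or_subset isOpen_Iio isOpen_Ioi
    Ioi_disjoint_Iio_same.symm cover).imp ?_ ?_
  · exact fun h s hs => ⟨(H.mapsTo hs).1, h (mem_image_of_mem w hs)⟩
  · exact fun h s hs => ⟨h (mem_image_of_mem w hs), (H.mapsTo hs).2⟩

theorem exists_eqOn_add_of_hasDerivAt {g : ℝ → ℝ} (hIo : IsOpen I) (hI : IsPreconnected I)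
    (hf : ∀ s ∈ I, HasDerivAt f (w s) s) (hg : ∀ s ∈ I, HasDerivAt g (w s) s) :
    ∃ a, EqOn f (fun s => g s + a) I :=
  hIo.exists_eq_add_of_deriv_eq hI
    (fun s hs => (hf s hs).differentiableAt.differentiableWithinAt)
    (fun s hs => (hg s hs).differentiableAt.differentiableWithinAt)
    fun s hs => (hf s hs).deriv.trans (hg s hs).deriv.symm

theorem injOn_of_hasDerivAt_ne_zero {h' : ℝ → ℝ} (hJ : J.OrdConnected)
    (hd : ∀ x ∈ J, HasDerivAt h (h' x) x) (h0 : ∀ x ∈ J, h' x ≠ 0) : InjOn h J := by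
  intro a ha b hb hab
  by_contra hne
  wlog hlt : a < b generalizing a b
  · exact this hb ha hab.symm (Ne.symm hne) ((not_lt.1 hlt).lt_of_ne' hne)
  have hsub : Icc a b ⊆ J := hJ.out ha hb
  obtain ⟨c, hc, hc0⟩ := exists_hasDerivAt_eq_zero hlt
    (fun x hx => (hd x (hsub hx)).continuousAt.continuousWithinAt) hab
    fun x hx => hd x (hsub (Ioo_subset_Icc_self hx))
  exact h0 c (hsub (Ioo_subset_Icc_self hc)) hc0

/-- On the open set `J` the field `v` does not vanish, and `h` is an antiderivative of `1 / v`
that maps `J` bijectively onto the line: `h x - h y` is the time that a solution of `w' = v w`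
takes to travel from `y` to `x`. -/
structure IsTravelTime (v h : ℝ → ℝ) (J : Set ℝ) : Prop where
  isOpen : IsOpen J
  ne_zero (x : ℝ) (hx : x ∈ J) : v x ≠ 0
  hasStrictDerivAt (x : ℝ) (hx : x ∈ J) : HasStrictDerivAt h (v x)⁻¹ x
  bijOn : BijOn h J univ

theorem exists_isInverseOn (hh : BijOn h J univ) : ∃ W, IsInverseOn h J W :=
  ⟨Function.invFunOn h J, hh.surjOn.mapsTo_invFunOn, hh.invOn_invFunOn⟩

namespace IsTravelTime

theorem of_surjOn (hJo : IsOpen J) (hJ : J.OrdConnected) (hv : ∀ x ∈ J, v x ≠ 0)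
    (hd : ∀ x ∈ J, HasStrictDerivAt h (v x)⁻¹ x) (hs : SurjOn h J univ) :
    IsTravelTime v h J :=
  ⟨hJo, hv, hd, mapsTo_univ _ _, injOn_of_hasDerivAt_ne_zero hJ
    (fun x hx => (hd x hx).hasDerivAt) fun x hx => inv_ne_zero (hv x hx), hs⟩

theorem hasDerivAt_of_isInverseOn (H : IsTravelTime v h J) (hW : IsInverseOn h J W) (s : ℝ) :
    HasDerivAt W (v (W s)) s := by
  have hWs : W s ∈ J := hW.1 (mem_univ s)
  have hd := (H.hasStrictDerivAt _ hWs).to_local_left_inverse (inv_ne_zero (H.ne_zero _ hWs)) <| by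
    filter_upwards [H.isOpen.mem_nhds hWs] with x hx using hW.2.1 hx
  rw [inv_inv, hW.2.2 (mem_univ s)] at hd
  exact hd.hasDerivAt

theorem isSolutionOn_of_isInverseOn (H : IsTravelTime v h J) (hW : IsInverseOn h J W)
    (s₀ f₀ : ℝ) :
    IsSolutionOn v J univ (fun s => (∫ r in s₀..s, W (r - s₀)) + f₀) fun s => W (s - s₀) := by
  have slope (s : ℝ) : HasDerivAt (fun s => W (s - s₀)) (v (W (s - s₀))) s :=
    (H.hasDerivAt_of_isInverseOn hW (s - s₀)).comp_sub_const s s₀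
  have hc : Continuous fun s => W (s - s₀) :=
    continuous_iff_continuousAt.2 fun s => (slope s).continuousAt
  refine ⟨fun s _ => ?_, fun s _ => slope s, fun s _ => hW.1 (mem_univ _)⟩
  exact (intervalIntegral.integral_hasDerivAt_right (hc.intervalIntegrable _ _)
    (hc.stronglyMeasurableAtFilter _ _) hc.continuousAt).add_const f₀

theorem exists_isSolutionOn (H : IsTravelTime v h J) (hf : IsPrimitiveOfInverse h J f) :
    ∃ w, IsSolutionOn v J univ f w := by
  obtain ⟨W, hW, s₀, f₀, hf⟩ := hf
  exact ⟨_, funext hf ▸ H.isSolutionOn_of_isInverseOn hW s₀ f₀⟩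

end IsTravelTime

theorem IsSolutionOn.exists_isPrimitiveOfInverse (hw : IsSolutionOn v J I f w)
    (H : IsTravelTime v h J) (hIo : IsOpen I) (hI : IsPreconnected I) :
    ∃ F, IsPrimitiveOfInverse h J F ∧ EqOn f F I := by
  obtain ⟨W, hW⟩ := exists_isInverseOn H.bijOn
  obtain ⟨a, ha⟩ : ∃ a, EqOn (h ∘ w) (fun s => s + a) I := by
    have hd (s : ℝ) (hs : s ∈ I) : HasDerivAt (h ∘ w) 1 s := by
      rw [← inv_mul_cancel₀ (H.ne_zero _ (hw.mapsTo hs))]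
      exact (H.hasStrictDerivAt _ (hw.mapsTo hs)).hasDerivAt.comp s (hw.hasDerivAt_slope s hs)
    exact exists_eqOn_add_of_hasDerivAt hIo hI hd fun s _ => hasDerivAt_id s
  have slope_eq : EqOn w (fun s => W (s - -a)) I := fun s hs => by
    simp only [sub_neg_eq_add, ← ha hs]
    exact (hW.2.1 (hw.mapsTo hs)).symm
  have sol := H.isSolutionOn_of_isInverseOn hW (-a) 0
  obtain ⟨b, hb⟩ := exists_eqOn_add_of_hasDerivAt hIo hI
    (fun s hs => slope_eq hs ▸ hw.hasDerivAt s hs) fun s _ => sol.hasDerivAt s (mem_univ s)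
  exact ⟨_, ⟨W, hW, -a, b, fun _ => rfl⟩, fun s hs => by simp only [hb hs, add_zero]⟩

end AutonomousEquation

/-! ### The profile equation -/

section ProfileEquation

variable {m x : ℝ} {I : Set ℝ} {f w : ℝ → ℝ}

theorem contDiff_profileField (m : ℝ) : ContDiff ℝ 1 (profileField m) := by
  unfold profileField
  fun_prop

theorem profileField_ne_zero (hx : x ∈ Ioo (-1) 1) (hmx : 1 - m * x ≠ 0) :
    profileField m x ≠ 0 :=
  mul_ne_zero (by nlinarith [hx.1, hx.2]) hmx

theorem profileField_one_div (hm : m ≠ 0) : profileField m (1 / m) = 0 := by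
  simp [profileField, hm]

theorem hasStrictDerivAt_P (hx : x ∈ Ioo (-1) 1) :
    HasStrictDerivAt P (profileField 1 x)⁻¹ x := by
  have h₁ : 1 - x ≠ 0 := by linarith [hx.2]
  have h₂ : 1 + x ≠ 0 := by linarith [hx.1]
  have sub := (hasStrictDerivAt_id x).const_sub 1
  have add := (hasStrictDerivAt_id x).const_add 1
  have hP := (((sub.log h₁).const_mul (-(1 / 4))).add
    ((((hasStrictDerivAt_const x 1).div sub h₁)).const_mul (1 / 2))).add
    ((add.log h₂).const_mul (1 / 4))
  unfold P
  simp only [Real.log_abs]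
  refine hP.congr_deriv ?_
  rw [profileField, show (1 - x ^ 2) * (1 - 1 * x) = (1 - x) ^ 2 * (1 + x) by ring]
  simp only [id]
  field_simp
  ring

theorem hasStrictDerivAt_Q (hm : 1 < m) (hx : x ∈ Ioo (-1) 1) (hmx : 1 - m * x ≠ 0) :
    HasStrictDerivAt (Q m) (profileField m x)⁻¹ x := by
  have h₁ : 1 - x ≠ 0 := by linarith [hx.2]
  have h₂ : 1 + x ≠ 0 := by linarith [hx.1]
  have m₁ : m - 1 ≠ 0 := by linarith
  have m₂ : m + 1 ≠ 0 := by linarith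
  have hQ := (((((hasStrictDerivAt_id x).const_sub 1).log h₁).const_mul (1 / (2 * m - 2))).add
    ((((hasStrictDerivAt_id x).const_add 1).log h₂).const_mul (1 / (2 * m + 2)))).sub
    (((((hasStrictDerivAt_id x).const_mul m).const_sub 1).log hmx).const_mul (m / (m ^ 2 - 1)))
  unfold Q
  simp only [Real.log_abs]
  refine hQ.congr_deriv ?_
  rw [profileField, show (1 - x ^ 2) * (1 - m * x) = (1 - x) * (1 + x) * (1 - m * x) by ring,
    show 2 * m - 2 = 2 * (m - 1) by ring, show 2 * m + 2 = 2 * (m + 1) by ring,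
    show m ^ 2 - 1 = (m - 1) * (m + 1) by ring]
  simp only [id]
  field_simp
  ring

theorem tendsto_log_abs_of_hasDerivAt {φ : ℝ → ℝ} {φ' b : ℝ} (hφ : HasDerivAt φ φ' b)
    (hφ' : φ' ≠ 0) (hb : φ b = 0) : Tendsto (fun x => Real.log |φ x|) (𝓝[≠] b) atBot := by
  simp only [Real.log_abs]
  exact Real.tendsto_log_nhdsNE_zero.comp (hb ▸ hφ.tendsto_nhdsNE hφ')

theorem tendsto_log_abs_one_add : Tendsto (fun x : ℝ => Real.log |1 + x|) (𝓝[≠] (-1)) atBot :=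
  tendsto_log_abs_of_hasDerivAt ((hasDerivAt_id _).const_add 1) one_ne_zero (by simp)

theorem tendsto_log_abs_one_sub : Tendsto (fun x : ℝ => Real.log |1 - x|) (𝓝[≠] 1) atBot :=
  tendsto_log_abs_of_hasDerivAt ((hasDerivAt_id _).const_sub 1) (by norm_num) (by simp)

theorem tendsto_P_neg_one : Tendsto P (𝓝[>] (-1)) atBot := by
  have regular : ContinuousAt
      (fun x : ℝ => -(1 / 4) * Real.log |1 - x| + 1 / 2 * (1 / (1 - x))) (-1) := by
    fun_prop (disch := norm_num)
  exact (regular.tendsto.mono_left nhdsWithin_le_nhds).add_atBot <|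
    (tendsto_log_abs_one_add.mono_left (nhdsGT_le_nhdsNE _)).const_mul_atBot (by norm_num)

theorem tendsto_P_one : Tendsto P (𝓝[<] 1) atTop := by
  have regular : ContinuousAt (fun x : ℝ => 1 / 4 * Real.log |1 + x|) 1 := by
    fun_prop (disch := norm_num)
  have log_term : Tendsto (fun x : ℝ => -(1 / 4) * Real.log |1 - x|) (𝓝[<] 1) atTop :=
    (tendsto_log_abs_one_sub.mono_left (nhdsLT_le_nhdsNE _)).const_mul_atBot_of_neg (by norm_num)
  have pole : Tendsto (fun x : ℝ => 1 / 2 * (1 / (1 - x))) (𝓝[<] 1) atTop := by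
    have one_sub : Tendsto (fun x : ℝ => 1 - x) (𝓝[<] 1) (𝓝[>] 0) :=
      tendsto_nhdsWithin_of_tendsto_nhds_of_eventually_within _
        (((continuous_sub_left 1).tendsto' 1 0 (sub_self 1)).mono_left nhdsWithin_le_nhds)
        (eventually_mem_nhdsWithin.mono fun _ hx => sub_pos.2 (mem_Iio.1 hx))
    simp only [one_div]
    exact one_sub.inv_tendsto_nhdsGT_zero.const_mul_atTop (by norm_num)
  exact (log_term.atTop_add_atTop pole).atTop_add (regular.tendsto.mono_left nhdsWithin_le_nhds)

theorem tendsto_Q_neg_one (hm : 1 < m) : Tendsto (Q m) (𝓝[≠] (-1)) atBot := by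
  have regular : ContinuousAt (fun x : ℝ => 1 / (2 * m - 2) * Real.log |1 - x| -
      m / (m ^ 2 - 1) * Real.log |1 - m * x|) (-1) := by
    fun_prop (disch := rw [abs_ne_zero]; linarith)
  refine ((regular.tendsto.mono_left nhdsWithin_le_nhds).add_atBot <|
    tendsto_log_abs_one_add.const_mul_atBot (r := 1 / (2 * m + 2)) ?_).congr fun x => ?_
  · positivity
  · rw [Q]
    ring

theorem tendsto_Q_one (hm : 1 < m) : Tendsto (Q m) (𝓝[≠] 1) atBot := by
  have regular : ContinuousAt (fun x : ℝ => 1 / (2 * m + 2) * Real.log |1 + x| -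
      m / (m ^ 2 - 1) * Real.log |1 - m * x|) 1 := by
    fun_prop (disch := rw [abs_ne_zero]; linarith)
  refine ((regular.tendsto.mono_left nhdsWithin_le_nhds).add_atBot <|
    tendsto_log_abs_one_sub.const_mul_atBot (r := 1 / (2 * m - 2)) ?_).congr fun x => ?_
  · exact one_div_pos.2 (by linarith)
  · rw [Q]
    ring

theorem one_div_mem_Ioo (hm : 1 < m) : 1 / m ∈ Ioo (-1) 1 :=
  ⟨by linarith [one_div_pos.2 (one_pos.trans hm)], (div_lt_one (one_pos.trans hm)).2 hm⟩

theorem tendsto_Q_one_div (hm : 1 < m) : Tendsto (Q m) (𝓝[≠] (1 / m)) atTop := by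
  have hm₀ : m ≠ 0 := by positivity
  have hmem := one_div_mem_Ioo hm
  have regular : ContinuousAt (fun x : ℝ => 1 / (2 * m - 2) * Real.log |1 - x| +
      1 / (2 * m + 2) * Real.log |1 + x|) (1 / m) := by
    fun_prop (disch := rw [abs_ne_zero]; linarith [hmem.1, hmem.2])
  have log_term : Tendsto (fun x => Real.log |1 - m * x|) (𝓝[≠] (1 / m)) atBot :=
    tendsto_log_abs_of_hasDerivAt (((hasDerivAt_id _).const_mul m).const_sub 1)
      (by simpa using hm₀) (by simp [hm₀])
  refine ((regular.tendsto.mono_left nhdsWithin_le_nhds).add_atTop <|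
    log_term.const_mul_atBot_of_neg (r := -(m / (m ^ 2 - 1))) ?_).congr fun x => ?_
  · exact neg_lt_zero.2 (div_pos (by linarith) (by nlinarith))
  · rw [Q]
    ring

theorem isTravelTime_P : IsTravelTime (profileField 1) P (Ioo (-1) 1) := by
  refine .of_surjOn isOpen_Ioo ordConnected_Ioo
    (fun x hx => profileField_ne_zero hx (by linarith [hx.2])) (fun x => hasStrictDerivAt_P) ?_
  refine ContinuousOn.surjOn_of_tendsto (nonempty_Ioo.2 (by norm_num))
    (fun x hx => (hasStrictDerivAt_P hx).hasDerivAt.continuousAt.continuousWithinAt) ?_ ?_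
  · exact (tendsto_comp_coe_Ioo_atBot (by norm_num)).2 tendsto_P_neg_one
  · exact (tendsto_comp_coe_Ioo_atTop (by norm_num)).2 tendsto_P_one

theorem isTravelTime_Q_lower (hm : 1 < m) :
    IsTravelTime (profileField m) (Q m) (Ioo (-1) (1 / m)) := by
  have hmem := one_div_mem_Ioo hm
  have hsub : Ioo (-1) (1 / m) ⊆ Ioo (-1) 1 := Ioo_subset_Ioo_right hmem.2.le
  have hne (x : ℝ) (hx : x ∈ Ioo (-1) (1 / m)) : 1 - m * x ≠ 0 := by
    linarith [(lt_div_iff₀' (one_pos.trans hm)).1 hx.2]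
  have hd (x : ℝ) (hx : x ∈ Ioo (-1) (1 / m)) := hasStrictDerivAt_Q hm (hsub hx) (hne x hx)
  refine .of_surjOn isOpen_Ioo ordConnected_Ioo
    (fun x hx => profileField_ne_zero (hsub hx) (hne x hx)) hd ?_
  refine ContinuousOn.surjOn_of_tendsto (nonempty_Ioo.2 hmem.1)
    (fun x hx => (hd x hx).hasDerivAt.continuousAt.continuousWithinAt) ?_ ?_
  · exact (tendsto_comp_coe_Ioo_atBot hmem.1).2
      ((tendsto_Q_neg_one hm).mono_left (nhdsGT_le_nhdsNE _))
  · exact (tendsto_comp_coe_Ioo_atTop hmem.1).2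
      ((tendsto_Q_one_div hm).mono_left (nhdsLT_le_nhdsNE _))

theorem isTravelTime_Q_upper (hm : 1 < m) :
    IsTravelTime (profileField m) (Q m) (Ioo (1 / m) 1) := by
  have hmem := one_div_mem_Ioo hm
  have hsub : Ioo (1 / m) 1 ⊆ Ioo (-1) 1 := Ioo_subset_Ioo_left hmem.1.le
  have hne (x : ℝ) (hx : x ∈ Ioo (1 / m) 1) : 1 - m * x ≠ 0 := by
    linarith [(div_lt_iff₀' (one_pos.trans hm)).1 hx.1]
  have hd (x : ℝ) (hx : x ∈ Ioo (1 / m) 1) := hasStrictDerivAt_Q hm (hsub hx) (hne x hx)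
  refine .of_surjOn isOpen_Ioo ordConnected_Ioo
    (fun x hx => profileField_ne_zero (hsub hx) (hne x hx)) hd ?_
  refine ContinuousOn.surjOn_of_tendsto' (nonempty_Ioo.2 hmem.2)
    (fun x hx => (hd x hx).hasDerivAt.continuousAt.continuousWithinAt) ?_ ?_
  · exact (tendsto_comp_coe_Ioo_atBot hmem.2).2
      ((tendsto_Q_one_div hm).mono_left (nhdsGT_le_nhdsNE _))
  · exact (tendsto_comp_coe_Ioo_atTop hmem.2).2
      ((tendsto_Q_one hm).mono_left (nhdsLT_le_nhdsNE _))

theorem isSolutionOn_linear (hm : 1 < m) (c : ℝ) :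
    IsSolutionOn (profileField m) (Ioo (-1) 1) univ (fun s => s / m + c) fun _ => 1 / m where
  hasDerivAt s _ := ((hasDerivAt_id s).div_const m).add_const c
  hasDerivAt_slope s _ := by
    simpa only [profileField_one_div (one_pos.trans hm).ne'] using hasDerivAt_const s (1 / m)
  mapsTo _ _ := one_div_mem_Ioo hm

theorem one_lt_cast_sub_one {n : ℕ} (hn : 2 < n) : 1 < (n : ℝ) - 1 := by
  have : (2 : ℝ) < n := by exact_mod_cast hn
  linarith

theorem IsProfile.exists_isSolutionOn {n : ℕ} (hf : IsProfile n f) :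
    ∃ w, IsSolutionOn (profileField ((n : ℝ) - 1)) (Ioo (-1) 1) univ f w := by
  rcases hf with ⟨hn, f₀, hf⟩ | ⟨rfl, hf⟩ | ⟨hn, hf⟩ | ⟨hn, hf⟩
  · exact ⟨_, funext hf ▸ isSolutionOn_linear (one_lt_cast_sub_one hn) f₀⟩
  · rw [show ((2 : ℕ) : ℝ) - 1 = 1 by norm_num]
    exact isTravelTime_P.exists_isSolutionOn hf
  · have hm := one_lt_cast_sub_one hn
    obtain ⟨w, hw⟩ := (isTravelTime_Q_lower hm).exists_isSolutionOn hf
    exact ⟨w, hw.mono (Ioo_subset_Ioo_right (one_div_mem_Ioo hm).2.le) subset_rfl⟩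
  · have hm := one_lt_cast_sub_one hn
    obtain ⟨w, hw⟩ := (isTravelTime_Q_upper hm).exists_isSolutionOn hf
    exact ⟨w, hw.mono (Ioo_subset_Ioo_left (one_div_mem_Ioo hm).1.le) subset_rfl⟩

theorem IsSolutionOn.exists_isProfile {n : ℕ} (hn : 2 ≤ n)
    (H : IsSolutionOn (profileField ((n : ℝ) - 1)) (Ioo (-1) 1) I f w) (hIo : IsOpen I)
    (hI : IsPreconnected I) : ∃ F, IsProfile n F ∧ EqOn f F I := by
  rcases hn.eq_or_lt with rfl | hn
  · rw [show ((2 : ℕ) : ℝ) - 1 = 1 by norm_num] at H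
    obtain ⟨F, hF, hfF⟩ := H.exists_isPrimitiveOfInverse isTravelTime_P hIo hI
    exact ⟨F, .inr (.inl ⟨rfl, hF⟩), hfF⟩
  have hm := one_lt_cast_sub_one hn
  rcases H.eqOn_or_mapsTo_or_mapsTo (contDiff_profileField _).locallyLipschitz
    (profileField_one_div (one_pos.trans hm).ne') hIo hI with hw | hw | hw
  · obtain ⟨a, ha⟩ := exists_eqOn_add_of_hasDerivAt hIo hI (fun s hs => hw hs ▸ H.hasDerivAt s hs)
      fun s _ => (hasDerivAt_id s).div_const ((n : ℝ) - 1)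
    exact ⟨_, .inl ⟨hn, a, fun _ => rfl⟩, ha⟩
  · obtain ⟨F, hF, hfF⟩ := IsSolutionOn.exists_isPrimitiveOfInverse
      { H with mapsTo := hw } (isTravelTime_Q_lower hm) hIo hI
    exact ⟨F, .inr (.inr (.inl ⟨hn, hF⟩)), hfF⟩
  · obtain ⟨F, hF, hfF⟩ := IsSolutionOn.exists_isPrimitiveOfInverse
      { H with mapsTo := hw } (isTravelTime_Q_upper hm) hIo hI
    exact ⟨F, .inr (.inr (.inr ⟨hn, hF⟩)), hfF⟩

end ProfileEquation

/-! ### Graphs over unions of horospheres -/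

section Horospheres

variable {n : ℕ} [NeZero n] {Ω : Set (Fin n → ℝ)} {u : (Fin n → ℝ) → ℝ} {x : Fin n → ℝ}
  {I : Set ℝ} {f w : ℝ → ℝ}

/-- The region `ρ⁻¹(I)` of `ℍⁿ`, a union of horospheres. -/
def slab (n : ℕ) [NeZero n] (I : Set ℝ) : Set (Fin n → ℝ) := {x ∈ halfSpace n | rho x ∈ I}

/-- The geodesic `s ↦ (e⁻ˢ, 0, …, 0)` orthogonal to the horospheres, a section of `ρ`. -/
noncomputable def verticalGeodesic (n : ℕ) [NeZero n] (s : ℝ) : Fin n → ℝ :=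
  Pi.single 0 (Real.exp (-s))

theorem rho_verticalGeodesic (s : ℝ) : rho (verticalGeodesic n s) = s := by
  simp [rho, verticalGeodesic]

theorem verticalGeodesic_mem_slab {s : ℝ} (hs : s ∈ I) : verticalGeodesic n s ∈ slab n I :=
  ⟨by simpa [halfSpace, verticalGeodesic] using Real.exp_pos (-s),
    by rwa [rho_verticalGeodesic]⟩

theorem verticalGeodesic_rho_zero (hx : 0 < x 0) : verticalGeodesic n (rho x) 0 = x 0 := by
  simp [verticalGeodesic, rho, Real.exp_log hx]

theorem contDiff_verticalGeodesic : ContDiff ℝ 2 (verticalGeodesic n) := by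
  refine contDiff_pi.2 fun i => ?_
  rcases eq_or_ne i 0 with rfl | hi
  · simp only [verticalGeodesic, Pi.single_eq_same]
    fun_prop
  · simpa only [verticalGeodesic, Pi.single_eq_of_ne hi] using contDiff_const

theorem isOpen_slab (hI : IsOpen I) : IsOpen (slab n I) :=
  ContinuousOn.isOpen_inter_preimage (fun _ hx => (continuousAt_rho hx.ne').continuousWithinAt)
    (isOpen_lt continuous_const (continuous_apply 0)) hI

theorem preimage_verticalGeodesic_slab : verticalGeodesic n ⁻¹' slab n I = I :=
  Subset.antisymm (fun s hs => by simpa only [rho_verticalGeodesic] using hs.2)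
    fun _ => verticalGeodesic_mem_slab

theorem image_rho_slab : rho '' slab n I = I :=
  Subset.antisymm (image_subset_iff.2 fun _ hx => hx.2)
    fun s hs => ⟨_, verticalGeodesic_mem_slab hs, rho_verticalGeodesic s⟩

theorem forall_mem_slab_iff {p : ℝ → Prop} :
    (∀ x ∈ slab n I, p (rho x)) ↔ ∀ s ∈ I, p s := by
  rw [← forall_mem_image, image_rho_slab]

theorem foliatedByHorospheres_iff (hΩ : Ω ⊆ halfSpace n) :
    FoliatedByHorospheres Ω u ↔
      ∃ (I : Set ℝ) (f : ℝ → ℝ), Ω = slab n I ∧ ∀ x ∈ Ω, u x = f (rho x) := by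
  constructor
  · intro h
    have mem_and_eq : ∀ x ∈ Ω, ∀ y, y 0 = x 0 → y ∈ Ω ∧ u y = u x := fun x hx y hy => by
      obtain ⟨c, -, t, ⟨hc, ht⟩, hsub⟩ := h (x, u x) ⟨x, hx, rfl⟩
      obtain ⟨z, hz, hzy⟩ := hsub (show (y, t) ∈ horosphere n c ×ˢ {t} from ⟨hy.trans hc, rfl⟩)
      obtain ⟨rfl, huz⟩ := Prod.mk.inj hzy
      exact ⟨hz, huz.trans ht.symm⟩
    refine ⟨verticalGeodesic n ⁻¹' Ω, u ∘ verticalGeodesic n, ?_, fun x hx =>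
      (mem_and_eq x hx _ (verticalGeodesic_rho_zero (hΩ hx))).2.symm⟩
    exact Subset.antisymm
      (fun x hx => ⟨hΩ hx, (mem_and_eq x hx _ (verticalGeodesic_rho_zero (hΩ hx))).1⟩)
      fun x hx => (mem_and_eq _ hx.2 x (verticalGeodesic_rho_zero hx.1).symm).1
  · rintro ⟨I, f, rfl, hu⟩ _ ⟨x, hx, rfl⟩
    refine ⟨x 0, hx.1, u x, ⟨rfl, rfl⟩, ?_⟩
    rintro ⟨y, _⟩ ⟨hy, rfl⟩
    have hyx : y 0 = x 0 := hy
    have hρ : rho y = rho x := by rw [rho, rho, hyx]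
    have hyI : y ∈ slab n I := ⟨hx.1.trans_eq hyx.symm, hρ ▸ hx.2⟩
    exact ⟨y, hyI, Prod.ext rfl (by simp only [hu y hyI, hu x hx, hρ])⟩

theorem isSpacelike_and_isTranslator_slab_iff (hI : IsOpen I)
    (hu : ∀ x ∈ slab n I, u x = f (rho x)) (hf : ∀ s ∈ I, HasDerivAt f (w s) s)
    (hw : ∀ s ∈ I, DifferentiableAt ℝ w s) :
    IsSpacelike (slab n I) u ∧ IsTranslator (slab n I) u ↔
      IsSolutionOn (profileField ((n : ℝ) - 1)) (Ioo (-1) 1) I f w := by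
  have jet : ∀ x ∈ slab n I, HasRadialJet u x (w (rho x)) (deriv w (rho x)) := fun x hx =>
    hasRadialJet_of_eventuallyEq hx.1 (eventually_of_mem ((isOpen_slab hI).mem_nhds hx) hu)
      (eventually_of_mem (hI.mem_nhds hx.2) hf) (hw _ hx.2).hasDerivAt
  have spacelike_iff : IsSpacelike (slab n I) u ↔ MapsTo w I (Ioo (-1) 1) :=
    (forall₂_congr fun x hx => (jet x hx).posDef_iff hx.1).trans
      (forall_mem_slab_iff (p := fun s => w s ∈ Ioo (-1) 1))
  have translator_iff (hmaps : MapsTo w I (Ioo (-1) 1)) : IsTranslator (slab n I) u ↔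
      ∀ s ∈ I, deriv w s = profileField ((n : ℝ) - 1) (w s) :=
    (forall₂_congr fun x hx => (jet x hx).meanCurvatureVector_eq_iff hx.1 (hmaps hx.2)).trans
      (forall_mem_slab_iff (p := fun s => deriv w s = profileField ((n : ℝ) - 1) (w s)))
  constructor
  · rintro ⟨hs, ht⟩
    have hmaps := spacelike_iff.1 hs
    exact ⟨hf, fun s hs => (translator_iff hmaps).1 ht s hs ▸ (hw s hs).hasDerivAt, hmaps⟩
  · intro H
    exact ⟨spacelike_iff.2 H.mapsTo,
      (translator_iff H.mapsTo).2 fun s hs => (H.hasDerivAt_slope s hs).deriv⟩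

theorem HasListedProfile.foliatedByHorospheres (hΩ : Ω ⊆ halfSpace n)
    (h : HasListedProfile Ω u) : FoliatedByHorospheres Ω u := by
  obtain ⟨I, -, -, hΩI, f, -, -, hu⟩ := h
  exact (foliatedByHorospheres_iff hΩ).2 ⟨I, f, hΩI, hu⟩

theorem HasListedProfile.isSpacelike_and_isTranslator (h : HasListedProfile Ω u) :
    IsSpacelike Ω u ∧ IsTranslator Ω u := by
  obtain ⟨I, hIo, -, rfl, f, -, hf, hu⟩ := h
  obtain ⟨w, hw⟩ := hf.exists_isSolutionOn
  have hwI := hw.mono subset_rfl (subset_univ I)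
  exact (isSpacelike_and_isTranslator_slab_iff hIo hu hwI.hasDerivAt
    fun s hs => (hwI.hasDerivAt_slope s hs).differentiableAt).2 hwI

theorem FoliatedByHorospheres.hasListedProfile (hn : 2 ≤ n) (hΩ : Ω ⊆ halfSpace n)
    (hΩo : IsOpen Ω) (hΩc : IsPreconnected Ω) (hu : ContDiffOn ℝ 2 u Ω) (hs : IsSpacelike Ω u)
    (ht : IsTranslator Ω u) (h : FoliatedByHorospheres Ω u) : HasListedProfile Ω u := by
  obtain ⟨I, f, rfl, huf⟩ := (foliatedByHorospheres_iff hΩ).1 h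
  have hIo : IsOpen I := by
    simpa only [preimage_verticalGeodesic_slab] using
      hΩo.preimage contDiff_verticalGeodesic.continuous
  have hIc : IsPreconnected I := by
    rw [← image_rho_slab (n := n) (I := I)]
    exact hΩc.image rho fun x hx => (continuousAt_rho hx.1.ne').continuousWithinAt
  have hf : ContDiffOn ℝ 2 f I :=
    (hu.comp contDiff_verticalGeodesic.contDiffOn fun _ => verticalGeodesic_mem_slab).congr
      fun s hs => by
        rw [Function.comp_apply, huf _ (verticalGeodesic_mem_slab hs), rho_verticalGeodesic]
  have hf' : ContDiffOn ℝ 1 (deriv f) I :=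
    ((contDiffOn_succ_iff_deriv_of_isOpen hIo).1 (by simpa only [one_add_one_eq_two])).2.2
  have hdf : ∀ s ∈ I, HasDerivAt f (deriv f s) s := fun s hs =>
    ((hf.contDiffAt (hIo.mem_nhds hs)).differentiableAt two_ne_zero).hasDerivAt
  have solution := (isSpacelike_and_isTranslator_slab_iff hIo huf hdf fun s hs =>
    (hf'.contDiffAt (hIo.mem_nhds hs)).differentiableAt one_ne_zero).1 ⟨hs, ht⟩
  obtain ⟨F, hF, hfF⟩ := solution.exists_isProfile hn hIo hIc
  obtain ⟨w, hw⟩ := hF.exists_isSolutionOn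
  exact ⟨I, hIo, hIc.ordConnected, rfl, F, hw.contDiff (contDiff_profileField _).continuous, hF,
    fun x hx => (huf x hx).trans (hfF hx.2)⟩

end Horospheres

end HESU

theorem theorem3p1 (n : ℕ) [NeZero n] (hn : 2 ≤ n) (Ω : Set (Fin n → ℝ))
    (hΩ : Ω ⊆ HESU.halfSpace n) (hΩo : IsOpen Ω) (hΩc : IsConnected Ω)
    (u : (Fin n → ℝ) → ℝ) (hu : ContDiffOn ℝ 2 u Ω) :
    (HESU.IsSpacelike Ω u → HESU.IsTranslator Ω u →
      (HESU.FoliatedByHorospheres Ω u ↔ HESU.HasListedProfile Ω u)) ∧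
    (HESU.HasListedProfile Ω u → HESU.IsSpacelike Ω u ∧ HESU.IsTranslator Ω u) :=
  ⟨fun hs ht => ⟨fun h => h.hasListedProfile hn hΩ hΩo hΩc.isPreconnected hu hs ht,
    fun h => h.foliatedByHorospheres hΩ⟩, fun h => h.isSpacelike_and_isTranslator⟩
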